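/- Let $m,n\ge 1$. For a real tensor $\mathcal A=(a_{i_1\cdots i_m})$ of order $m$ and dimension $n$ put $\mathcal A\mathbf x^m=\sum_{i_1,\dots,i_m=1}^n a_{i_1\cdots i_m}x_{i_1}\cdots x_{i_m}$. Call $\mathcal A$ symmetric if its entries are invariant under permutations of the indices, and copositive if $\mathcal A\mathbf x^m\ge 0$ for all $\mathbf x\in\mathbb R^n$ with nonnegative coordinates. A symmetric tensor $\mathcal A$ is an extended $Z$-tensor if, writing $\mathcal A\mathbf x^m=\sum_{|\alpha|=m}f_\alpha\mathbf x^\alpha$, there are $s\le n$ and pairwise disjoint sets $\Gamma_1,\dots,\Gamma_s$ with union $\{1,\dots,n\}$ such that $$\mathcal A\mathbf x^m=\sum_{i=1}^n f_{m\mathbf e_i}x_i^m+\sum_{l=1}^s\sum_{\alpha\in\Omega_l}f_\alpha\mathbf x^\alpha ,$$ where $\Omega_l$ is the set of exponents $\alpha\in\mathbb Z_{\ge0}^n$ with $|\alpha|=m$, with support contained in $\Gamma_l$, and with $\alpha\ne m\mathbf e_i$ for all $i$, and such that for each $l$ either $f_\alpha\neq0$ for at most one $\alpha\in\Omega_l$,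 or $f_\alpha\le0$ for all $\alpha\in\Omega_l$. Let $\mathcal A$ be a symmetric extended $Z$-tensor of order $m$ (odd or even) and dimension $n$, and let $\mathcal A_h$ be the symmetric tensor of order $2m$ and dimension $n$ with $\mathcal A_h\mathbf x^{2m}=\sum_{i_1,\dots,i_m=1}^n a_{i_1\cdots i_m}x_{i_1}^2\cdots x_{i_m}^2$. Then the minimum $$v=\min_{t\in\mathbb R}\Big\{t : t\sum_{i=1}^n x_i^{2m}+\mathcal A_h\mathbf x^{2m}\ \text{is a sum of squares of real polynomials}\Big\}$$ is attained, and $\mathcal A$ is copositive if and only if $v\le0$. -/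

import Mathlib

open MvPolynomial

noncomputable section

/-- A real tensor of order `m` and dimension `n`: the array of its entries `a_{i₁ ⋯ i_m}`. -/
abbrev Tensor (m n : ℕ) : Type := (Fin m → Fin n) → ℝ

namespace Tensor

variable {m n : ℕ}

/-- The entries are invariant under every permutation of the indices. -/
def IsSymm (A : Tensor m n) : Prop :=
  ∀ (σ : Equiv.Perm (Fin m)) (i : Fin m → Fin n), A (i ∘ σ) = A i

/-- The homogeneous polynomial `A x^m = ∑ a_{i₁ ⋯ i_m} x_{i₁} ⋯ x_{i_m}`. -/
def form (A : Tensor m n) : MvPolynomial (Fin n) ℝ :=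
  ∑ i : Fin m → Fin n, C (A i) * ∏ k, X (i k)

/-- `A x^m ≥ 0` on the nonnegative orthant. -/
def IsCopositive (A : Tensor m n) : Prop :=
  ∀ x : Fin n → ℝ, (∀ i, 0 ≤ x i) → 0 ≤ eval x A.form

/-- The exponents `α` with `|α| = m` of the monomials in the variables `x_i`, `i ∈ Γ`, other than
the pure powers `x_i^m`. -/
def mixedExponents (m : ℕ) (Γ : Finset (Fin n)) : Finset (Fin n →₀ ℕ) :=
  {α ∈ Γ.finsuppAntidiag m | ∀ i, α ≠ Finsupp.single i m}

/-- Extended `Z`-tensors: the index set is partitioned into blocks `Γ_l`, no monomial of `A x^m`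
involves variables of two blocks, and in each block either at most one mixed monomial has a nonzero
coefficient or all the mixed monomials have nonpositive coefficients. -/
def IsExtendedZ (A : Tensor m n) : Prop :=
  A.IsSymm ∧ ∃ s : ℕ, s ≤ n ∧ ∃ Γ : Fin s → Finset (Fin n),
    (∀ i, ∃ l, i ∈ Γ l) ∧
    (∀ l₁ l₂, l₁ ≠ l₂ → Disjoint (Γ l₁) (Γ l₂)) ∧
    A.form = ∑ i, monomial (Finsupp.single i m) (coeff (Finsupp.single i m) A.form) +
      ∑ l, ∑ α ∈ mixedExponents m (Γ l), monomial α (coeff α A.form) ∧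
    ∀ l, (∃ β, ∀ α ∈ mixedExponents m (Γ l), α ≠ β → coeff α A.form = 0) ∨
      (∀ α ∈ mixedExponents m (Γ l), coeff α A.form ≤ 0)

/-- The index `(i₁, i₁, i₂, i₂, …, i_m, i_m)`. -/
def doubleIndex (i : Fin m → Fin n) : Fin (2 * m) → Fin n :=
  fun p => i ⟨p / 2, by omega⟩

/-- The symmetric tensor `A_h` of order `2m` with
`A_h x^{2m} = ∑ a_{i₁ ⋯ i_m} x_{i₁}² ⋯ x_{i_m}²` (see `form_squared` and `isSymm_squared`): the
symmetrization of the array that has the entry `a_{i₁ ⋯ i_m}` at `(i₁, i₁, …, i_m, i_m)` and zeros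
elsewhere. -/
def squared (A : Tensor m n) : Tensor (2 * m) n := fun j =>
  (∑ σ : Equiv.Perm (Fin (2 * m)), ∑ i : Fin m → Fin n,
    if j ∘ σ = doubleIndex i then A i else 0) / ((2 * m).factorial : ℝ)

theorem isSymm_squared (A : Tensor m n) : A.squared.IsSymm := by
  intro τ j
  unfold squared
  congr 1
  exact Fintype.sum_equiv (Equiv.mulLeft τ) _ _ fun σ => rfl

theorem prod_doubleIndex {R : Type*} [CommMonoid R] (x : Fin n → R) (i : Fin m → Fin n) :
    ∏ p, x (doubleIndex i p) = ∏ k, x (i k) ^ 2 := by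
  have h := Fintype.prod_equiv (finProdFinEquiv.trans (finCongr (mul_comm m 2)))
    (fun q : Fin m × Fin 2 => x (i q.1)) (fun p => x (doubleIndex i p)) (by
      rintro ⟨k, r⟩
      unfold doubleIndex
      congr 2
      ext
      simp
      omega)
  rw [← h, Fintype.prod_prod_type]
  simp

theorem form_squared (A : Tensor m n) :
    A.squared.form = ∑ i : Fin m → Fin n, C (A i) * ∏ k, (X (i k) : MvPolynomial (Fin n) ℝ) ^ 2 := by
  have key : ∀ σ : Equiv.Perm (Fin (2 * m)),
      (∑ j : Fin (2 * m) → Fin n, ∑ i : Fin m → Fin n,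
        C (if j ∘ σ = doubleIndex i then A i else 0) * ∏ p, (X (j p) : MvPolynomial (Fin n) ℝ)) =
      ∑ i : Fin m → Fin n, C (A i) * ∏ k, (X (i k) : MvPolynomial (Fin n) ℝ) ^ 2 := by
    intro σ
    rw [Finset.sum_comm]
    refine Finset.sum_congr rfl fun i _ => ?_
    rw [Finset.sum_eq_single (doubleIndex i ∘ σ.symm)]
    · rw [if_pos (by funext p; simp), ← prod_doubleIndex]
      congr 1
      exact Fintype.prod_equiv σ.symm _ _ fun p => rfl
    · intro j _ hj
      rw [if_neg, C_0, zero_mul]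
      intro h
      apply hj
      rw [← h]
      funext p
      simp
    · simp
  have hf : ((2 * m).factorial : ℝ) ≠ 0 := by positivity
  unfold form squared
  simp only [div_eq_mul_inv, C_mul, map_sum, Finset.sum_mul]
  rw [Finset.sum_comm]
  have : ∀ σ : Equiv.Perm (Fin (2 * m)),
      (∑ j : Fin (2 * m) → Fin n, ∑ i : Fin m → Fin n,
        C (if j ∘ σ = doubleIndex i then A i else 0) * C ((2 * m).factorial : ℝ)⁻¹ *
          ∏ p, (X (j p) : MvPolynomial (Fin n) ℝ)) =
      C ((2 * m).factorial : ℝ)⁻¹ *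
        ∑ i : Fin m → Fin n, C (A i) * ∏ k, (X (i k) : MvPolynomial (Fin n) ℝ) ^ 2 := by
    intro σ
    rw [← key σ, Finset.mul_sum]
    refine Finset.sum_congr rfl fun j _ => ?_
    rw [Finset.mul_sum]
    exact Finset.sum_congr rfl fun i _ => by ring
  rw [Finset.sum_congr rfl fun σ _ => this σ, Finset.sum_const, Finset.card_univ,
    Fintype.card_perm, Fintype.card_fin, nsmul_eq_mul, ← mul_assoc,
    ← map_natCast (C : ℝ →+* MvPolynomial (Fin n) ℝ), ← C_mul, mul_inv_cancel₀ hf, C_1, one_mul]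

end Tensor

/-- The sums of squares of real polynomials in `n` variables, of degree at most `d`. -/
def sosPolynomials (n d : ℕ) : Set (MvPolynomial (Fin n) ℝ) :=
  {p | p.totalDegree ≤ d ∧
    ∃ (r : ℕ) (q : Fin r → MvPolynomial (Fin n) ℝ), p = ∑ k, q k ^ 2}

/-- `‖x‖_d^d = ∑ |x_i|^d` as a polynomial; used only for even `d`, where `|x_i|^d = x_i^d`. -/
def normPow (n d : ℕ) : MvPolynomial (Fin n) ℝ := ∑ i, X i ^ d

end

/-!
Substituting `x_i ^ 2` for `x_i` turns copositivity of a form into nonnegativity, so it suffices to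
write `f (x_1 ^ 2, …, x_n ^ 2)` as a sum of squares whenever `f` is copositive and no mixed monomial
with a positive coefficient shares a variable with one with a negative coefficient. Setting the
variables of the positive mixed monomials to `0` shows that the diagonal of such an `f` already
dominates the negative part, so that only `∑ c_i y_i ^ m - ∑ b_k y ^ α_k` with `b_k > 0` matters.

If this is nonnegative for `y ≥ 0`, then adding `δ ∑ y_i ^ m - ∑ log y_i` produces a minimiser with
positive coordinates. The weighted arithmetic-geometric mean inequalities for the `y ^ α_k` that are
tangent at this point have weights whose `b_k`-combination is at most `c_i + δ`, and compactness
gives admissible weights for `δ = 0`. Each of these inequalities is a sum of squares by Hurwitz's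
theorem, and hence so is the form.
-/

section SumsOfSquares

theorem isSumSq_pow {R : Type*} [CommSemiring R] {x : R} (hx : IsSumSq x) (k : ℕ) :
    IsSumSq (x ^ k) := by
  simpa only [Subsemiring.mem_sumSq] using pow_mem (Subsemiring.mem_sumSq.2 hx) k

theorem exists_eq_sum_fin_sq_of_isSumSq {R : Type*} [CommSemiring R] {x : R} (hx : IsSumSq x) :
    ∃ (r : ℕ) (q : Fin r → R), x = ∑ k, q k ^ 2 := by
  induction hx with
  | zero => exact ⟨0, Fin.elim0, by simp⟩
  | sq_add a _ ih =>
    obtain ⟨r, q, rfl⟩ := ih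
    exact ⟨r + 1, Fin.cons a q, by simp [Fin.sum_univ_succ, sq]⟩

theorem isSumSq_sub_mul_pow_sub_pow {R : Type*} [CommRing R] {a b : R} (ha : IsSumSq a)
    (hb : IsSumSq b) (k : ℕ) : IsSumSq ((a - b) * (a ^ k - b ^ k)) := by
  have hfactor : (a - b) * (a ^ k - b ^ k) =
      ((a - b) * (a - b)) * ∑ i ∈ Finset.range k, a ^ i * b ^ (k - 1 - i) := by
    rw [← (Commute.all a b).mul_geom_sum₂ k, mul_assoc]
  rw [hfactor]
  exact (IsSumSq.mul_self _).mul
    (IsSumSq.sum fun i _ => (isSumSq_pow ha _).mul (isSumSq_pow hb _))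

variable {R : Type*} [CommRing R] [Algebra ℝ R]

theorem isSumSq_algebraMap {c : ℝ} (hc : 0 ≤ c) : IsSumSq (algebraMap ℝ R c) := by
  have h := IsSumSq.mul_self (algebraMap ℝ R (√c))
  rwa [← map_mul, Real.mul_self_sqrt hc] at h

theorem isSumSq_of_algebraMap_mul {c : ℝ} (hc : 0 < c) {x : R}
    (h : IsSumSq (algebraMap ℝ R c * x)) : IsSumSq x := by
  have h' := (isSumSq_algebraMap (R := R) (inv_nonneg.2 hc.le)).mul h
  rwa [← mul_assoc, ← map_mul, inv_mul_cancel₀ hc.ne', map_one, one_mul] at h'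

end SumsOfSquares

section Hurwitz

variable {R κ : Type*} [CommRing R]

theorem sum_sum_sub_mul_pow_sub_pow (s : Finset κ) (a : κ → R) (d : ℕ) :
    ∑ j ∈ s, ∑ k ∈ s, (a j - a k) * (a j ^ d - a k ^ d) =
      2 * (s.card * ∑ k ∈ s, a k ^ (d + 1) - (∑ j ∈ s, a j) * ∑ k ∈ s, a k ^ d) := by
  have hexpand : ∀ j k, (a j - a k) * (a j ^ d - a k ^ d) =
      a j ^ (d + 1) + a k ^ (d + 1) - a j * a k ^ d - a j ^ d * a k := fun j k => by ring
  simp only [hexpand, Finset.sum_sub_distrib, Finset.sum_add_distrib, ← Finset.mul_sum,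
    ← Finset.sum_mul, Finset.sum_const, nsmul_eq_mul]
  ring

theorem sum_mul_sum_erase_pow_sub_prod [DecidableEq κ] (s : Finset κ) (a : κ → R) (d : ℕ) :
    ∑ j ∈ s, a j * (∑ k ∈ s.erase j, a k ^ d - d * ∏ k ∈ s.erase j, a k) =
      (∑ j ∈ s, a j) * ∑ k ∈ s, a k ^ d - ∑ k ∈ s, a k ^ (d + 1) -
        d * s.card * ∏ k ∈ s, a k := by
  have hterm : ∀ j ∈ s, a j * (∑ k ∈ s.erase j, a k ^ d - d * ∏ k ∈ s.erase j, a k) =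
      a j * ∑ k ∈ s, a k ^ d - a j ^ (d + 1) - d * ∏ k ∈ s, a k := fun j hj => by
    rw [← Finset.add_sum_erase s _ hj, ← Finset.mul_prod_erase s _ hj]
    ring
  rw [Finset.sum_congr rfl hterm]
  simp only [Finset.sum_sub_distrib, ← Finset.sum_mul, Finset.sum_const, nsmul_eq_mul]
  ring

variable [Algebra ℝ R]

/-- **Hurwitz's theorem** on the arithmetic-geometric mean inequality. -/
theorem isSumSq_sum_pow_card_sub_card_mul_prod (a : κ → R) (ha : ∀ k, IsSumSq (a k))
    (s : Finset κ) : IsSumSq (∑ k ∈ s, a k ^ s.card - s.card * ∏ k ∈ s, a k) := by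
  classical
  obtain ⟨d, hd⟩ : ∃ d, s.card = d := ⟨_, rfl⟩
  induction d generalizing s with
  | zero => simp [Finset.card_eq_zero.1 hd]
  | succ d ih =>
    rcases Nat.eq_zero_or_pos d with rfl | hpos
    · obtain ⟨k, rfl⟩ := Finset.card_eq_one.1 hd
      simp
    have hpairs : IsSumSq (∑ j ∈ s, ∑ k ∈ s, (a j - a k) * (a j ^ d - a k ^ d)) :=
      IsSumSq.sum fun j _ => IsSumSq.sum fun k _ => isSumSq_sub_mul_pow_sub_pow (ha j) (ha k) d
    have herase :
        IsSumSq (∑ j ∈ s, a j * (∑ k ∈ s.erase j, a k ^ d - d * ∏ k ∈ s.erase j, a k)) := by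
      refine IsSumSq.sum fun j hj => (ha j).mul ?_
      have hcard : (s.erase j).card = d := by rw [Finset.card_erase_of_mem hj, hd]; rfl
      simpa only [hcard] using ih (s.erase j) hcard
    refine isSumSq_of_algebraMap_mul (c := 2 * d) (by positivity) ?_
    convert! hpairs.add (herase.add herase) using 1
    rw [sum_sum_sub_mul_pow_sub_pow, sum_mul_sum_erase_pow_sub_prod, hd]
    simp only [map_mul, map_natCast, map_ofNat, Nat.cast_add, Nat.cast_one]
    ring

theorem isSumSq_sum_mul_pow_sub_mul_prod_pow {ι : Type*} [Fintype ι] (a : ι → R)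
    (ha : ∀ i, IsSumSq (a i)) {m : ℕ} {α : ι → ℕ} (hα : ∑ i, α i = m) :
    IsSumSq (∑ i, α i * a i ^ m - m * ∏ i, a i ^ α i) := by
  have h := isSumSq_sum_pow_card_sub_card_mul_prod (fun p : (i : ι) × Fin (α i) => a p.1)
    (fun p => ha p.1) Finset.univ
  have hcard : (Finset.univ : Finset ((i : ι) × Fin (α i))).card = m := by simp [← hα]
  rw [hcard, Fintype.sum_sigma, Fintype.prod_sigma] at h
  simpa using h

end Hurwitz

/-- The nonnegative weights `w` whose circuit number `∏ (m w_i / α_i) ^ (α_i / m)` is at least `1`.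
For `|α| = m` these are the weights with `x ^ α ≤ ∑ w_i x_i ^ m` on the nonnegative orthant. The
condition is written without division and without roots, so that it makes sense for `α_i = 0`. -/
def amGmWeights {ι : Type*} [Fintype ι] (m : ℕ) (α : ι → ℕ) : Set (ι → ℝ) :=
  {w | (∀ i, 0 ≤ w i) ∧ ∏ i, (α i : ℝ) ^ α i ≤ ∏ i, (m * w i) ^ α i}

section Weights

variable {ι : Type*} [Fintype ι] {m : ℕ} {α : ι → ℕ}

theorem isClosed_amGmWeights : IsClosed (amGmWeights m α) := by
  simp only [amGmWeights, Set.ofPred_and, Set.ofPred_forall]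
  exact (isClosed_iInter fun i => isClosed_le continuous_const (continuous_apply i)).inter
    (isClosed_le continuous_const (by fun_prop))

theorem tangent_mem_amGmWeights (hm : m ≠ 0) (hα : ∑ i, α i = m) {y : ι → ℝ}
    (hy : ∀ i, 0 < y i) :
    (fun i => α i * (∏ j, y j ^ α j) / (m * y i ^ m)) ∈ amGmWeights m α := by
  have hP : 0 < ∏ j, y j ^ α j := Finset.prod_pos fun j _ => pow_pos (hy j) _
  refine ⟨fun i => by have := hy i; positivity, le_of_eq ?_⟩
  have hcancel : ∀ i, m * (α i * (∏ j, y j ^ α j) / (m * y i ^ m)) =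
      α i * ((∏ j, y j ^ α j) / y i ^ m) := fun i => by field_simp
  symm
  calc ∏ i, (m * (α i * (∏ j, y j ^ α j) / (m * y i ^ m))) ^ α i
      = (∏ i, (α i : ℝ) ^ α i) * ((∏ j, y j ^ α j) ^ m / ∏ i, (y i ^ α i) ^ m) := by
        simp_rw [hcancel, mul_pow, div_pow, Finset.prod_mul_distrib, Finset.prod_div_distrib,
          Finset.prod_pow_eq_pow_sum, hα, ← pow_mul, mul_comm m]
    _ = ∏ i, (α i : ℝ) ^ α i := by
        rw [Finset.prod_pow, div_self (pow_pos hP m).ne', mul_one]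

variable {R : Type*} [CommRing R] [Algebra ℝ R]

theorem isSumSq_sum_mul_pow_sub_prod_pow_of_scaling (hm : m ≠ 0) (hα : ∑ i, α i = m)
    {w s : ι → ℝ} (hs : ∀ i, 0 ≤ s i) (hle : ∀ i, α i * s i ^ m ≤ m * w i)
    (hprod : 1 ≤ ∏ i, s i ^ α i) (a : ι → R) (ha : ∀ i, IsSumSq (a i)) :
    IsSumSq (∑ i, algebraMap ℝ R (w i) * a i ^ m - ∏ i, a i ^ α i) := by
  have hslack : IsSumSq (∑ i, algebraMap ℝ R (m * w i - α i * s i ^ m) * a i ^ m) :=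
    IsSumSq.sum fun i _ =>
      (isSumSq_algebraMap (sub_nonneg.2 (hle i))).mul (isSumSq_pow (ha i) m)
  have hmean := isSumSq_sum_mul_pow_sub_mul_prod_pow (fun i => algebraMap ℝ R (s i) * a i)
    (fun i => (isSumSq_algebraMap (hs i)).mul (ha i)) hα
  have hexcess : IsSumSq (algebraMap ℝ R (m * (∏ i, s i ^ α i - 1)) * ∏ i, a i ^ α i) :=
    (isSumSq_algebraMap (mul_nonneg m.cast_nonneg (sub_nonneg.2 hprod))).mul
      (IsSumSq.prod fun i _ => isSumSq_pow (ha i) _)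
  refine isSumSq_of_algebraMap_mul (c := m) (by positivity) ?_
  convert! (hslack.add hmean).add hexcess using 1
  simp only [mul_pow, map_sub, map_mul, map_pow, map_prod, map_natCast, map_one, sub_mul,
    Finset.sum_sub_distrib, Finset.prod_mul_distrib, mul_sub, Finset.mul_sum, mul_assoc]
  ring

theorem isSumSq_sum_mul_pow_sub_prod_pow (hm : m ≠ 0) (hα : ∑ i, α i = m) {w : ι → ℝ}
    (hw : w ∈ amGmWeights m α) (a : ι → R) (ha : ∀ i, IsSumSq (a i)) :
    IsSumSq (∑ i, algebraMap ℝ R (w i) * a i ^ m - ∏ i, a i ^ α i) := by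
  obtain ⟨hw0, hcircuit⟩ := hw
  have hquot : ∀ i, 0 ≤ m * w i / α i := fun i => by have := hw0 i; positivity
  set s : ι → ℝ := fun i => (m * w i / α i) ^ (m⁻¹ : ℝ)
  have hs : ∀ i, 0 ≤ s i := fun i => Real.rpow_nonneg (hquot i) _
  have hsm : ∀ i, s i ^ m = m * w i / α i := fun i => Real.rpow_inv_natCast_pow (hquot i) hm
  refine isSumSq_sum_mul_pow_sub_prod_pow_of_scaling hm hα hs (fun i => ?_) ?_ a ha
  · rcases eq_or_ne (α i) 0 with hi | hi
    · simpa [hi] using mul_nonneg m.cast_nonneg (hw0 i)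
    · rw [hsm, mul_div_cancel₀ _ (Nat.cast_ne_zero.2 hi)]
  · have hpos : (0 : ℝ) < ∏ i, (α i : ℝ) ^ α i :=
      Finset.prod_pos fun i _ => by exact_mod_cast Nat.pow_self_pos
    have hpow : 1 ≤ (∏ i, s i ^ α i) ^ m :=
      calc 1 ≤ (∏ i, (m * w i) ^ α i) / ∏ i, (α i : ℝ) ^ α i := (one_le_div hpos).2 hcircuit
        _ = ∏ i, (s i ^ m) ^ α i := by simp only [hsm, div_pow, Finset.prod_div_distrib]
        _ = (∏ i, s i ^ α i) ^ m := by simp only [← Finset.prod_pow, ← pow_mul, mul_comm]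
    exact (one_le_pow_iff_of_nonneg (Finset.prod_nonneg fun i _ => pow_nonneg (hs i) _) hm).1 hpow

end Weights

section LogBarrier

variable {ι : Type*} [Fintype ι] {m : ℕ}

theorem exists_abs_sub_le_mul_exp_pow_sub (hm : m ≠ 0) {δ : ℝ} (hδ : 0 < δ) :
    ∃ K, ∀ x : ℝ, |x| - K ≤ δ * Real.exp x ^ m - x := by
  set s := Real.log (2 / δ)
  refine ⟨2 * |s|, fun x => ?_⟩
  rcases le_total x 0 with hx | hx
  · rw [abs_of_nonpos hx]
    have := mul_pos hδ (pow_pos (Real.exp_pos x) m)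
    linarith [abs_nonneg s]
  · have hexp : 2 / δ * Real.exp (x - s) = Real.exp x := by
      rw [Real.exp_sub, Real.exp_log (by positivity)]
      field_simp
    have hpow : Real.exp x ≤ Real.exp x ^ m := le_self_pow₀ (Real.one_le_exp hx) hm
    have htangent : 2 * (x - s + 1) ≤ δ * Real.exp x ^ m :=
      calc 2 * (x - s + 1) ≤ 2 * Real.exp (x - s) := by linarith [Real.add_one_le_exp (x - s)]
        _ = δ * Real.exp x := by rw [← hexp]; field_simp
        _ ≤ _ := mul_le_mul_of_nonneg_left hpow hδ.le
    rw [abs_of_nonneg hx]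
    linarith [le_abs_self s]

theorem exists_pos_forall_sub_sum_log_le (hm : m ≠ 0) {G : (ι → ℝ) → ℝ} (hG : Continuous G)
    {δ : ℝ} (hδ : 0 < δ) (h : ∀ y : ι → ℝ, (∀ i, 0 < y i) → δ * ∑ i, y i ^ m ≤ G y) :
    ∃ y : ι → ℝ, (∀ i, 0 < y i) ∧ ∀ z : ι → ℝ, (∀ i, 0 < z i) →
      G y - ∑ i, Real.log (y i) ≤ G z - ∑ i, Real.log (z i) := by
  obtain ⟨K, hK⟩ := exists_abs_sub_le_mul_exp_pow_sub hm hδ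
  set Φ : (ι → ℝ) → ℝ := fun u => G (fun i => Real.exp (u i)) - ∑ i, u i
  have hcont : Continuous Φ := by fun_prop
  have hlower : ∀ u, ‖u‖ - Fintype.card ι * K ≤ Φ u := fun u =>
    calc ‖u‖ - Fintype.card ι * K ≤ ∑ i, |u i| - Fintype.card ι * K := by
          gcongr
          exact (pi_norm_le_iff_of_nonneg (Finset.sum_nonneg fun i _ => abs_nonneg _)).2 fun i =>
            Finset.single_le_sum (f := fun i => |u i|) (fun i _ => abs_nonneg _)
              (Finset.mem_univ i)
      _ = ∑ i, (|u i| - K) := by simp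
      _ ≤ ∑ i, (δ * Real.exp (u i) ^ m - u i) := Finset.sum_le_sum fun i _ => hK (u i)
      _ ≤ Φ u := by
          rw [Finset.sum_sub_distrib, ← Finset.mul_sum]
          exact sub_le_sub_right (h _ fun i => Real.exp_pos _) _
  have hcoercive : Filter.Tendsto Φ (Filter.cocompact _) Filter.atTop :=
    Filter.tendsto_atTop_mono hlower
      (Filter.tendsto_atTop_add_const_right _ _ (tendsto_norm_cocompact_atTop (E := ι → ℝ)))
  obtain ⟨u, hu⟩ := hcont.exists_forall_le hcoercive
  refine ⟨fun i => Real.exp (u i), fun i => Real.exp_pos _, fun z hz => ?_⟩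
  simpa [Φ, Real.exp_log (hz _)] using hu fun i => Real.log (z i)

theorem prod_update_mul_pow {M : Type*} [CommMonoid M] [DecidableEq ι] (y : ι → M) (i : ι)
    (s : M) (α : ι → ℕ) :
    ∏ j, Function.update y i (s * y i) j ^ α j = s ^ α i * ∏ j, y j ^ α j := by
  rw [← Finset.mul_prod_erase _ _ (Finset.mem_univ i),
    ← Finset.mul_prod_erase _ (fun j => y j ^ α j) (Finset.mem_univ i), ← mul_assoc]
  congr 1
  · rw [Function.update_self, mul_pow]
  · exact Finset.prod_congr rfl fun j hj => by
      rw [Function.update_of_ne (Finset.ne_of_mem_erase hj)]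

theorem sum_apply_update [DecidableEq ι] {M : Type*} (g : ι → M → ℝ) (y : ι → M) (i : ι) (x : M) :
    ∑ j, g j (Function.update y i x j) = ∑ j, g j (y j) + (g i x - g i (y i)) := by
  rw [← Finset.add_sum_erase _ _ (Finset.mem_univ i),
    ← Finset.add_sum_erase _ (fun j => g j (y j)) (Finset.mem_univ i), Function.update_self,
    Finset.sum_congr rfl fun j hj => by rw [Function.update_of_ne (Finset.ne_of_mem_erase hj)]]
  ring

variable {κ : Type*} [Fintype κ] {α : κ → ι → ℕ} {b : κ → ℝ} {c : ι → ℝ}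

/-- At a minimiser of `∑ (c_i + δ) y_i ^ m - ∑ b_k y ^ α_k - ∑ log y_i`, stationarity under scaling
of `y_i` says that the two sides differ by exactly `1`. -/
theorem exists_pos_sum_mul_prod_pow_le (hm : m ≠ 0)
    (h : ∀ y : ι → ℝ, (∀ i, 0 < y i) → ∑ k, b k * ∏ i, y i ^ α k i ≤ ∑ i, c i * y i ^ m)
    {δ : ℝ} (hδ : 0 < δ) :
    ∃ y : ι → ℝ, (∀ i, 0 < y i) ∧
      ∀ i, ∑ k, b k * (∏ j, y j ^ α k j) * α k i ≤ (c i + δ) * y i ^ m * m := by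
  classical
  obtain ⟨y, hy, hmin⟩ := exists_pos_forall_sub_sum_log_le hm
    (G := fun y => ∑ i, (c i + δ) * y i ^ m - ∑ k, b k * ∏ i, y i ^ α k i) (by fun_prop) hδ
    fun y hy => by
      simp only [add_mul, Finset.sum_add_distrib, ← Finset.mul_sum]
      linarith [h y hy]
  refine ⟨y, hy, fun i => ?_⟩
  set P : κ → ℝ := fun k => ∏ j, y j ^ α k j
  set φ : ℝ → ℝ := fun s =>
    (c i + δ) * y i ^ m * s ^ m - ∑ k, b k * P k * s ^ α k i - Real.log s
  have hφ : IsLocalMin φ 1 := by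
    filter_upwards [Ioi_mem_nhds (zero_lt_one' ℝ)] with s (hs : 0 < s)
    have hle := hmin (Function.update y i (s * y i)) fun j => by
      rcases eq_or_ne j i with rfl | hj
      · simpa using mul_pos hs (hy j)
      · simpa [hj] using hy j
    simp only [prod_update_mul_pow, sum_apply_update (fun j x => (c j + δ) * x ^ m),
      sum_apply_update (fun _ x => Real.log x), Real.log_mul hs.ne' (hy i).ne', mul_pow] at hle
    simp only [φ, P, one_pow, Real.log_one, mul_one, one_mul, mul_assoc,
      mul_comm (∏ j, y j ^ α _ j)]
    linarith
  have hderiv : HasDerivAt φ ((c i + δ) * y i ^ m * m - ∑ k, b k * P k * α k i - 1) 1 := by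
    have hpow : ∀ d : ℕ, HasDerivAt (fun s : ℝ => s ^ d) d 1 := fun d => by
      simpa using hasDerivAt_pow d (1 : ℝ)
    have hlog : HasDerivAt Real.log 1 1 := by simpa using Real.hasDerivAt_log one_ne_zero
    exact (((hpow m).const_mul _).sub
      (HasDerivAt.fun_sum fun k _ => (hpow (α k i)).const_mul _)).sub hlog
  linarith [hφ.hasDerivAt_eq_zero hderiv]

end LogBarrier

section DiagonalMinusTail

variable {ι κ : Type*} [Fintype ι] [Fintype κ] {m : ℕ} {α : κ → ι → ℕ} {b : κ → ℝ} {c : ι → ℝ}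

theorem exists_amGmWeights_sum_mul_le_add (hm : m ≠ 0) (hα : ∀ k, ∑ i, α k i = m)
    (h : ∀ y : ι → ℝ, (∀ i, 0 < y i) → ∑ k, b k * ∏ i, y i ^ α k i ≤ ∑ i, c i * y i ^ m)
    {δ : ℝ} (hδ : 0 < δ) :
    ∃ w : κ → ι → ℝ, (∀ k, w k ∈ amGmWeights m (α k)) ∧ ∀ i, ∑ k, b k * w k i ≤ c i + δ := by
  obtain ⟨y, hy, hle⟩ := exists_pos_sum_mul_prod_pow_le hm h hδ
  refine ⟨fun k i => α k i * (∏ j, y j ^ α k j) / (m * y i ^ m),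
    fun k => tangent_mem_amGmWeights hm (hα k) hy, fun i => ?_⟩
  have hscale : 0 < m * y i ^ m := mul_pos (by positivity) (pow_pos (hy i) m)
  calc ∑ k, b k * (α k i * (∏ j, y j ^ α k j) / (m * y i ^ m))
      = (∑ k, b k * (∏ j, y j ^ α k j) * α k i) / (m * y i ^ m) := by
        rw [Finset.sum_div]
        exact Finset.sum_congr rfl fun k _ => by ring
    _ ≤ c i + δ := (div_le_iff₀ hscale).2 ((hle i).trans_eq (by ring))

theorem exists_amGmWeights_sum_mul_le (hm : m ≠ 0) (hα : ∀ k, ∑ i, α k i = m)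
    (hb : ∀ k, 0 < b k)
    (h : ∀ y : ι → ℝ, (∀ i, 0 < y i) → ∑ k, b k * ∏ i, y i ^ α k i ≤ ∑ i, c i * y i ^ m) :
    ∃ w : κ → ι → ℝ, (∀ k, w k ∈ amGmWeights m (α k)) ∧ ∀ i, ∑ k, b k * w k i ≤ c i := by
  choose w hw hle using fun N : ℕ =>
    exists_amGmWeights_sum_mul_le_add hm hα h (Nat.one_div_pos_of_nat (α := ℝ) (n := N))
  have hbounded : ∀ N, w N ∈ Set.Icc (0 : κ → ι → ℝ) fun k i => (c i + 1) / b k := fun N => by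
    refine ⟨fun k i => (hw N k).1 i, fun k i => (le_div_iff₀' (hb k)).2 ?_⟩
    calc b k * w N k i ≤ ∑ k, b k * w N k i :=
          Finset.single_le_sum (f := fun k => b k * w N k i)
            (fun k _ => mul_nonneg (hb k).le ((hw N k).1 i)) (Finset.mem_univ k)
      _ ≤ c i + 1 / (N + 1) := hle N i
      _ ≤ c i + 1 := by gcongr; exact (div_le_one (by positivity)).2 (by simp)
  obtain ⟨w', -, φ, hφ, hlim⟩ := isCompact_Icc.tendsto_subseq hbounded
  refine ⟨w', fun k => isClosed_amGmWeights.mem_of_tendsto (tendsto_pi_nhds.1 hlim k)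
    (Filter.Eventually.of_forall fun N => hw (φ N) k), fun i => ?_⟩
  have hlimsum : Filter.Tendsto (fun N => ∑ k, b k * w (φ N) k i) Filter.atTop
      (nhds (∑ k, b k * w' k i)) :=
    tendsto_finsetSum _ fun k _ =>
      (tendsto_pi_nhds.1 (tendsto_pi_nhds.1 hlim k) i).const_mul (b k)
  have hlimbound : Filter.Tendsto (fun N => c i + 1 / ((φ N : ℝ) + 1)) Filter.atTop
      (nhds (c i)) := by
    simpa using (tendsto_one_div_add_atTop_nhds_zero_nat.comp hφ.tendsto_atTop).const_add (c i)
  exact le_of_tendsto_of_tendsto' hlimsum hlimbound fun N => hle (φ N) i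

/-- **Fidalgo–Kovacec**, with arbitrary sums of squares substituted for the variables. -/
theorem isSumSq_diagonal_sub_tail {R : Type*} [CommRing R] [Algebra ℝ R] (hm : m ≠ 0)
    (hα : ∀ k, ∑ i, α k i = m) (hb : ∀ k, 0 < b k)
    (h : ∀ y : ι → ℝ, (∀ i, 0 < y i) → ∑ k, b k * ∏ i, y i ^ α k i ≤ ∑ i, c i * y i ^ m)
    (a : ι → R) (ha : ∀ i, IsSumSq (a i)) :
    IsSumSq (∑ i, algebraMap ℝ R (c i) * a i ^ m -
      ∑ k, algebraMap ℝ R (b k) * ∏ i, a i ^ α k i) := by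
  obtain ⟨w, hw, hwc⟩ := exists_amGmWeights_sum_mul_le hm hα hb h
  have hslack : IsSumSq (∑ i, algebraMap ℝ R (c i - ∑ k, b k * w k i) * a i ^ m) :=
    IsSumSq.sum fun i _ =>
      (isSumSq_algebraMap (sub_nonneg.2 (hwc i))).mul (isSumSq_pow (ha i) m)
  have hmean : IsSumSq (∑ k, algebraMap ℝ R (b k) *
      (∑ i, algebraMap ℝ R (w k i) * a i ^ m - ∏ i, a i ^ α k i)) :=
    IsSumSq.sum fun k _ => (isSumSq_algebraMap (hb k).le).mul
      (isSumSq_sum_mul_pow_sub_prod_pow hm (hα k) (hw k) a ha)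
  convert! hslack.add hmean using 1
  simp only [map_sub, map_sum, map_mul, sub_mul, mul_sub, Finset.sum_sub_distrib, Finset.sum_mul,
    Finset.mul_sum, mul_assoc]
  rw [Finset.sum_comm (s := (Finset.univ : Finset ι))]
  ring

end DiagonalMinusTail

section MixedMonomials

open scoped Classical in
/-- The exponents of the monomials of `f` other than the pure powers `x_i ^ m`. -/
noncomputable def mixedSupport {ι S : Type*} [CommSemiring S] (m : ℕ) (f : MvPolynomial ι S) :
    Finset (ι →₀ ℕ) :=
  {α ∈ f.support | ∀ i, α ≠ Finsupp.single i m}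

section Semiring

variable {ι S : Type*} [CommSemiring S] {m : ℕ} {f : MvPolynomial ι S}

theorem mem_mixedSupport {α : ι →₀ ℕ} :
    α ∈ mixedSupport m f ↔ coeff α f ≠ 0 ∧ ∀ i, α ≠ Finsupp.single i m := by
  simp [mixedSupport]

theorem degree_eq_of_mem_mixedSupport (hf : f.IsHomogeneous m) {α : ι →₀ ℕ}
    (hα : α ∈ mixedSupport m f) : α.degree = m :=
  not_imp_comm.1 hf.coeff_eq_zero (mem_mixedSupport.1 hα).1

theorem exists_ne_apply_ne_zero_of_mem_mixedSupport (hf : f.IsHomogeneous m) {α : ι →₀ ℕ}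
    (hα : α ∈ mixedSupport m f) (i : ι) : ∃ j, j ≠ i ∧ α j ≠ 0 := by
  by_contra! hall
  have hsingle : α = Finsupp.single i (α i) := by
    ext j
    rcases eq_or_ne j i with rfl | hj
    · rw [Finsupp.single_eq_same]
    · rw [hall j hj, Finsupp.single_eq_of_ne hj]
  have hdegree : α i = m := by
    rw [← degree_eq_of_mem_mixedSupport hf hα, hsingle, Finsupp.degree_single,
      Finsupp.single_eq_same]
  exact (mem_mixedSupport.1 hα).2 i (hdegree ▸ hsingle)

variable [Fintype ι]

theorem aeval_eq_sum_single_add_sum_mixedSupport {R : Type*} [CommSemiring R] [Algebra S R]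
    (hm : m ≠ 0) (a : ι → R) :
    aeval a f = ∑ i, algebraMap S R (coeff (Finsupp.single i m) f) * a i ^ m +
      ∑ α ∈ mixedSupport m f, algebraMap S R (coeff α f) * ∏ i, a i ^ α i := by
  classical
  have hinj : Function.Injective fun i : ι => Finsupp.single i m :=
    Finsupp.single_left_injective hm
  have hpure : ∑ α ∈ f.support with ¬∀ i, α ≠ Finsupp.single i m,
      algebraMap S R (coeff α f) * ∏ i, a i ^ α i =
        ∑ i, algebraMap S R (coeff (Finsupp.single i m) f) * a i ^ m := by
    calc _ = ∑ α ∈ Finset.univ.image fun i => Finsupp.single i m,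
            algebraMap S R (coeff α f) * ∏ i, a i ^ α i := by
          refine Finset.sum_subset (fun α hα => ?_) fun α hα hα' => ?_
          · simpa [eq_comm] using (Finset.mem_filter.1 hα).2
          · have : coeff α f = 0 := by
              by_contra hne
              simp_all [eq_comm]
            simp [this]
      _ = _ := by
          rw [Finset.sum_image hinj.injOn]
          refine Finset.sum_congr rfl fun i _ => ?_
          rw [← Finsupp.prod_fintype _ _ fun j => pow_zero (a j),
            Finsupp.prod_single_index (h := fun i k => a i ^ k) (pow_zero _)]
  rw [aeval_def, eval₂_eq', ← hpure, add_comm, mixedSupport,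
    Finset.sum_filter_add_sum_filter_not]

theorem eval_eq_sum_single_add_sum_mixedSupport (hm : m ≠ 0) (y : ι → S) :
    eval y f = ∑ i, coeff (Finsupp.single i m) f * y i ^ m +
      ∑ α ∈ mixedSupport m f, coeff α f * ∏ i, y i ^ α i := by
  simpa only [aeval_eq_eval, Algebra.algebraMap_self, RingHom.id_apply] using
    aeval_eq_sum_single_add_sum_mixedSupport (f := f) hm y

end Semiring

/-- No mixed monomial of `f` with a positive coefficient shares a variable with a mixed monomial
with a negative coefficient; the pure powers `x_i ^ m` are unrestricted. The form of an extended
`Z`-tensor has this property, because no block has mixed monomials of both signs. -/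
def HasSeparatedMixedSigns {ι : Type*} (m : ℕ) (f : MvPolynomial ι ℝ) : Prop :=
  ∀ α ∈ mixedSupport m f, ∀ β ∈ mixedSupport m f, 0 < coeff α f → coeff β f < 0 →
    Disjoint α.support β.support

variable {ι : Type*} {m : ℕ} {f : MvPolynomial ι ℝ}

theorem coeff_single_nonneg [Finite ι] (hm : m ≠ 0) (hf : f.IsHomogeneous m)
    (hnonneg : ∀ y : ι → ℝ, (∀ i, 0 ≤ y i) → 0 ≤ eval y f) (i : ι) :
    0 ≤ coeff (Finsupp.single i m) f := by
  classical
  cases nonempty_fintype ι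
  have hmixed : ∀ α ∈ mixedSupport m f, ∏ j, (Pi.single i 1 : ι → ℝ) j ^ α j = 0 := fun α hα => by
    obtain ⟨j, hj, hαj⟩ := exists_ne_apply_ne_zero_of_mem_mixedSupport hf hα i
    exact Finset.prod_eq_zero (Finset.mem_univ j) (by simp [hj, hαj])
  have hvertex : eval (Pi.single i 1) f = coeff (Finsupp.single i m) f := by
    rw [eval_eq_sum_single_add_sum_mixedSupport hm,
      Finset.sum_eq_zero (s := mixedSupport m f) fun α hα => by rw [hmixed α hα, mul_zero]]
    simp [Pi.single_apply, hm]
  have hsingle : (0 : ι → ℝ) ≤ Pi.single i 1 := Pi.single_nonneg.2 zero_le_one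
  exact hvertex ▸ hnonneg _ hsingle

/-- The witness sets the variables of the positive mixed monomials to `0`. -/
theorem exists_sum_mixedSupport_eq_sum_neg [Fintype ι] (hm : m ≠ 0) (hf : f.IsHomogeneous m)
    (hsep : HasSeparatedMixedSigns m f) {y : ι → ℝ} (hy : ∀ i, 0 ≤ y i) :
    ∃ z : ι → ℝ, (∀ i, 0 ≤ z i) ∧ (∀ i, z i ≤ y i) ∧
      ∑ α ∈ mixedSupport m f, coeff α f * ∏ i, z i ^ α i =
        ∑ α ∈ mixedSupport m f with coeff α f < 0, coeff α f * ∏ i, y i ^ α i := by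
  set V : Set ι := {j | ∀ β ∈ mixedSupport m f, 0 < coeff β f → β j = 0}
  have hneg : ∀ α ∈ mixedSupport m f, coeff α f < 0 →
      ∏ i, V.indicator y i ^ α i = ∏ i, y i ^ α i := by
    refine fun α hα hαneg => Finset.prod_congr rfl fun j _ => ?_
    rcases eq_or_ne (α j) 0 with hj | hj
    · rw [hj, pow_zero, pow_zero]
    · rw [Set.indicator_of_mem]
      exact fun β hβ hβpos => Finsupp.notMem_support_iff.1 <|
        Finset.disjoint_right.1 (hsep β hβ α hα hβpos hαneg) (Finsupp.mem_support_iff.2 hj)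
  have hpos : ∀ α ∈ mixedSupport m f, 0 < coeff α f → ∏ i, V.indicator y i ^ α i = 0 := by
    intro α hα hαpos
    obtain ⟨j, hj⟩ := DFunLike.ne_iff.1 <| (Finsupp.degree_eq_zero_iff α).not.1
      ((degree_eq_of_mem_mixedSupport hf hα).trans_ne hm)
    refine Finset.prod_eq_zero (Finset.mem_univ j) ?_
    rw [Set.indicator_of_notMem fun hjV : j ∈ V => hj (hjV α hα hαpos), zero_pow hj]
  refine ⟨V.indicator y, Set.indicator_nonneg fun i _ => hy i,
    fun i => Set.indicator_apply_le' (fun _ => le_rfl) fun _ => hy i, ?_⟩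
  rw [Finset.sum_filter]
  refine Finset.sum_congr rfl fun α hα => ?_
  split_ifs with hαneg
  · rw [hneg α hα hαneg]
  · rw [hpos α hα ((not_lt.1 hαneg).lt_of_ne' (mem_mixedSupport.1 hα).1), mul_zero]

theorem sum_neg_mixedSupport_le [Fintype ι] (hm : m ≠ 0) (hf : f.IsHomogeneous m)
    (hsep : HasSeparatedMixedSigns m f)
    (hnonneg : ∀ y : ι → ℝ, (∀ i, 0 ≤ y i) → 0 ≤ eval y f) {y : ι → ℝ} (hy : ∀ i, 0 ≤ y i) :
    ∑ α ∈ mixedSupport m f with coeff α f < 0, -coeff α f * ∏ i, y i ^ α i ≤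
      ∑ i, coeff (Finsupp.single i m) f * y i ^ m := by
  obtain ⟨z, hz, hzy, hmixed⟩ := exists_sum_mixedSupport_eq_sum_neg hm hf hsep hy
  have hdiag : ∑ i, coeff (Finsupp.single i m) f * z i ^ m ≤
      ∑ i, coeff (Finsupp.single i m) f * y i ^ m := Finset.sum_le_sum fun i _ =>
    mul_le_mul_of_nonneg_left (pow_le_pow_left₀ (hz i) (hzy i) m)
      (coeff_single_nonneg hm hf hnonneg i)
  have heval := hnonneg z hz
  rw [eval_eq_sum_single_add_sum_mixedSupport hm, hmixed] at heval
  simp only [neg_mul, Finset.sum_neg_distrib]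
  linarith

theorem isSumSq_aeval_of_nonneg [Finite ι] {R : Type*} [CommRing R] [Algebra ℝ R] (hm : m ≠ 0)
    (hf : f.IsHomogeneous m) (hsep : HasSeparatedMixedSigns m f)
    (hnonneg : ∀ y : ι → ℝ, (∀ i, 0 ≤ y i) → 0 ≤ eval y f) (a : ι → R)
    (ha : ∀ i, IsSumSq (a i)) : IsSumSq (aeval a f) := by
  cases nonempty_fintype ι
  set N := {α ∈ mixedSupport m f | coeff α f < 0}
  have hN : ∀ k : N, k.1 ∈ mixedSupport m f ∧ coeff k.1 f < 0 := fun k => Finset.mem_filter.1 k.2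
  have htail := isSumSq_diagonal_sub_tail (κ := N) (α := fun k i => k.1 i)
    (b := fun k => -coeff k.1 f) hm
    (fun k => (Finsupp.degree_eq_sum k.1).symm.trans (degree_eq_of_mem_mixedSupport hf (hN k).1))
    (fun k => neg_pos.2 (hN k).2)
    (fun y hy => (Finset.sum_coe_sort N fun α => -coeff α f * ∏ i, y i ^ α i).trans_le
      (sum_neg_mixedSupport_le hm hf hsep hnonneg fun i => (hy i).le)) a ha
  rw [Finset.sum_coe_sort N fun α => algebraMap ℝ R (-coeff α f) * ∏ i, a i ^ α i] at htail
  have hpos : IsSumSq (∑ α ∈ mixedSupport m f with ¬coeff α f < 0,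
      algebraMap ℝ R (coeff α f) * ∏ i, a i ^ α i) :=
    IsSumSq.sum fun α hα => (isSumSq_algebraMap (not_lt.1 (Finset.mem_filter.1 hα).2)).mul
      (IsSumSq.prod fun i _ => isSumSq_pow (ha i) _)
  convert! htail.add hpos using 1
  rw [aeval_eq_sum_single_add_sum_mixedSupport hm,
    ← Finset.sum_filter_add_sum_filter_not (mixedSupport m f) (coeff · f < 0)]
  simp only [N, map_neg, neg_mul, Finset.sum_neg_distrib, sub_neg_eq_add, add_assoc]

end MixedMonomials

theorem mem_sosPolynomials_iff_isSumSq {n d : ℕ} {p : MvPolynomial (Fin n) ℝ} :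
    p ∈ sosPolynomials n d ↔ p.totalDegree ≤ d ∧ IsSumSq p :=
  and_congr_right fun _ =>
    ⟨fun ⟨_, _, h⟩ => h ▸ IsSumSq.sum_sq _ _, exists_eq_sum_fin_sq_of_isSumSq⟩

theorem expand_mem_sosPolynomials_iff {m n : ℕ} (hm : m ≠ 0) {f : MvPolynomial (Fin n) ℝ}
    (hf : f.IsHomogeneous m) (hsep : HasSeparatedMixedSigns m f) :
    expand 2 f ∈ sosPolynomials n (2 * m) ↔
      ∀ y : Fin n → ℝ, (∀ i, 0 ≤ y i) → 0 ≤ eval y f := by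
  rw [mem_sosPolynomials_iff_isSumSq]
  constructor
  · rintro ⟨-, hsos⟩ y hy
    have hsqrt : (fun i => √(y i)) ^ 2 = y := funext fun i => Real.sq_sqrt (hy i)
    obtain ⟨r, q, hq⟩ := exists_eq_sum_fin_sq_of_isSumSq hsos
    rw [← hsqrt, ← eval_expand, hq]
    simp only [map_sum, map_pow]
    positivity
  · intro hnonneg
    refine ⟨?_, isSumSq_aeval_of_nonneg hm hf hsep hnonneg _ fun i => (IsSquare.sq _).isSumSq⟩
    rw [totalDegree_expand, mul_comm]
    exact Nat.mul_le_mul_left 2 hf.totalDegree_le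

theorem isHomogeneous_normPow (n d : ℕ) : (normPow n d).IsHomogeneous d :=
  IsHomogeneous.sum _ _ _ fun i _ => isHomogeneous_X_pow i d

theorem coeff_normPow_eq_zero {n d : ℕ} {α : Fin n →₀ ℕ} (hα : ∀ i, α ≠ Finsupp.single i d) :
    coeff α (normPow n d) = 0 := by
  simp [normPow, coeff_sum, coeff_X_pow, fun i => (hα i).symm]

theorem hasSeparatedMixedSigns_C_mul_normPow_add {m n : ℕ} {f : MvPolynomial (Fin n) ℝ}
    (hf : HasSeparatedMixedSigns m f) (t : ℝ) :
    HasSeparatedMixedSigns m (C t * normPow n m + f) := by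
  have hcoeff : ∀ α : Fin n →₀ ℕ, (∀ i, α ≠ Finsupp.single i m) →
      coeff α (C t * normPow n m + f) = coeff α f := fun α hα => by
    rw [coeff_add, coeff_C_mul, coeff_normPow_eq_zero hα, mul_zero, zero_add]
  intro α hα β hβ
  rw [mem_mixedSupport] at hα hβ
  rw [hcoeff α hα.2] at hα ⊢
  rw [hcoeff β hβ.2] at hβ ⊢
  exact hf α (mem_mixedSupport.2 hα) β (mem_mixedSupport.2 hβ)

namespace Tensor

variable {m n : ℕ} {A : Tensor m n}

theorem isHomogeneous_form (A : Tensor m n) : A.form.IsHomogeneous m := by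
  refine IsHomogeneous.sum _ _ _ fun i _ => ?_
  have hprod := IsHomogeneous.prod Finset.univ (fun k => (X (i k) : MvPolynomial (Fin n) ℝ))
    (fun _ => 1) fun k _ => isHomogeneous_X ℝ (i k)
  simpa using (isHomogeneous_C (Fin n) (A i)).mul hprod

theorem expand_form (A : Tensor m n) : expand 2 A.form = A.squared.form := by
  rw [form_squared, form]
  simp

theorem eval_form (A : Tensor m n) (y : Fin n → ℝ) :
    eval y A.form = ∑ i, A i * ∏ k, y (i k) := by
  simp [form]

theorem neg_sum_abs_mul_le_eval_form (hm : 0 < m) (A : Tensor m n) {y : Fin n → ℝ}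
    (hy : ∀ i, 0 ≤ y i) : -((∑ i, |A i|) * ∑ j, y j ^ m) ≤ eval y A.form := by
  have hmonomial : ∀ i : Fin m → Fin n, ∏ k, y (i k) ≤ ∑ j, y j ^ m := fun i => by
    obtain ⟨k, -, hk⟩ := Finset.exists_max_image Finset.univ (fun k => y (i k))
      ⟨⟨0, hm⟩, Finset.mem_univ _⟩
    calc ∏ k, y (i k) ≤ y (i k) ^ m := by
          simpa using Finset.prod_le_prod (fun k _ => hy (i k)) fun k' hk' => hk k' hk'
      _ ≤ ∑ j, y j ^ m := Finset.single_le_sum (f := fun j => y j ^ m)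
          (fun j _ => pow_nonneg (hy j) m) (Finset.mem_univ (i k))
  rw [eval_form, Finset.sum_mul, ← Finset.sum_neg_distrib]
  refine Finset.sum_le_sum fun i _ => neg_le_of_abs_le ?_
  rw [abs_mul, abs_of_nonneg (Finset.prod_nonneg fun k _ => hy (i k))]
  exact mul_le_mul_of_nonneg_left (hmonomial i) (abs_nonneg _)

theorem IsExtendedZ.hasSeparatedMixedSigns (hA : A.IsExtendedZ) :
    HasSeparatedMixedSigns m A.form := by
  obtain ⟨-, s, -, Γ, -, hΓ, hform, hsign⟩ := hA
  have hblock : ∀ α ∈ mixedSupport m A.form, ∃ l, α ∈ mixedExponents m (Γ l) := by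
    intro α hα
    obtain ⟨hα0, hαmixed⟩ := mem_mixedSupport.1 hα
    by_contra! hnone
    refine hα0 ?_
    rw [hform, coeff_add, coeff_sum, coeff_sum, Finset.sum_eq_zero, Finset.sum_eq_zero, add_zero]
    · intro l _
      rw [coeff_sum]
      exact Finset.sum_eq_zero fun β hβ => by
        rw [coeff_monomial, if_neg (ne_of_mem_of_not_mem hβ (hnone l))]
    · exact fun i _ => by rw [coeff_monomial, if_neg (hαmixed i).symm]
  have hsupport : ∀ l, ∀ α ∈ mixedExponents m (Γ l), α.support ⊆ Γ l := fun l α hα =>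
    (Finset.mem_finsuppAntidiag.1 (Finset.mem_filter.1 hα).1).2
  intro α hα β hβ hαpos hβneg
  obtain ⟨l, hl⟩ := hblock α hα
  obtain ⟨l', hl'⟩ := hblock β hβ
  rcases eq_or_ne l l' with rfl | hll'
  · rcases hsign l with ⟨γ, hγ⟩ | hnonpos
    · have hαγ : α = γ := not_imp_comm.1 (hγ α hl) hαpos.ne'
      have hβγ : β = γ := not_imp_comm.1 (hγ β hl') hβneg.ne
      exact absurd hαpos (hαγ.trans hβγ.symm ▸ hβneg.not_gt)
    · exact absurd hαpos (hnonpos α hl).not_gt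
  · exact (hΓ l l' hll').mono (hsupport l α hl) (hsupport l' β hl')

/-- The `t` for which `t ∑ x_i ^ m + A x ^ m` is nonnegative on the nonnegative orthant. -/
def copositiveShifts (A : Tensor m n) : Set ℝ :=
  {t | ∀ y : Fin n → ℝ, (∀ i, 0 ≤ y i) → 0 ≤ t * ∑ i, y i ^ m + eval y A.form}

theorem mem_sosPolynomials_iff_mem_copositiveShifts (hm : m ≠ 0)
    (hA : HasSeparatedMixedSigns m A.form) (t : ℝ) :
    C t * normPow n (2 * m) + A.squared.form ∈ sosPolynomials n (2 * m) ↔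
      t ∈ A.copositiveShifts := by
  have hexpand : expand 2 (C t * normPow n m + A.form) =
      C t * normPow n (2 * m) + A.squared.form := by
    simp [← expand_form, normPow, pow_mul]
  have hhom : (C t * normPow n m + A.form).IsHomogeneous m :=
    ((isHomogeneous_normPow n m).C_mul t).add A.isHomogeneous_form
  rw [← hexpand, expand_mem_sosPolynomials_iff hm hhom
    (hasSeparatedMixedSigns_C_mul_normPow_add hA t)]
  simp [copositiveShifts, normPow]

theorem isClosed_copositiveShifts : IsClosed A.copositiveShifts := by
  simp only [copositiveShifts, Set.ofPred_forall]
  exact isClosed_iInter fun y => isClosed_iInter fun _ => isClosed_le continuous_const (by fun_prop)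

theorem exists_isLeast_copositiveShifts (hm : 0 < m) (hn : 0 < n) (A : Tensor m n) :
    ∃ v, IsLeast A.copositiveShifts v := by
  have hne : A.copositiveShifts.Nonempty := ⟨∑ i, |A i|, fun y hy => by
    linarith [neg_sum_abs_mul_le_eval_form hm A hy]⟩
  have hbdd : BddBelow A.copositiveShifts := by
    refine ⟨-eval 1 A.form / n, fun t ht => ?_⟩
    have hone : 0 ≤ t * n + eval 1 A.form := by simpa using ht 1 fun _ => zero_le_one
    rw [div_le_iff₀ (Nat.cast_pos.2 hn)]
    linarith
  exact ⟨_, isClosed_copositiveShifts.isLeast_csInf hne hbdd⟩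

theorem isCopositive_iff_of_isLeast_copositiveShifts {v : ℝ}
    (hv : IsLeast A.copositiveShifts v) : A.IsCopositive ↔ v ≤ 0 := by
  refine ⟨fun h => hv.2 fun y hy => by simpa using h y hy, fun hv0 y hy => ?_⟩
  have hnorm : 0 ≤ ∑ i, y i ^ m := Finset.sum_nonneg fun i _ => pow_nonneg (hy i) m
  linarith [hv.1 y hy, mul_nonpos_of_nonpos_of_nonneg hv0 hnorm]

end Tensor

theorem corollary5p1_general {m n : ℕ} (hm : 0 < m) (hn : 0 < n) {A : Tensor m n}
    (hA : HasSeparatedMixedSigns m A.form) :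
    ∃ v : ℝ,
      IsLeast {t : ℝ | MvPolynomial.C t * normPow n (2 * m) + A.squared.form ∈
        sosPolynomials n (2 * m)} v ∧
      (A.IsCopositive ↔ v ≤ 0) := by
  simp only [Tensor.mem_sosPolynomials_iff_mem_copositiveShifts hm.ne' hA, Set.ofPred_mem_eq]
  obtain ⟨v, hv⟩ := Tensor.exists_isLeast_copositiveShifts hm hn A
  exact ⟨v, hv, Tensor.isCopositive_iff_of_isLeast_copositiveShifts hv⟩

theorem corollary5p1 (m n : ℕ) (hm : 0 < m) (hn : 0 < n) (A : Tensor m n) (hA : A.IsExtendedZ) :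
    ∃ v : ℝ,
      IsLeast {t : ℝ | MvPolynomial.C t * normPow n (2 * m) + A.squared.form ∈
        sosPolynomials n (2 * m)} v ∧
      (A.IsCopositive ↔ v ≤ 0) :=
  corollary5p1_general hm hn hA.hasSeparatedMixedSigns
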